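/- For a nonzero polynomial $f\in\mathbb Z[z]$ let $N(f)$ and $U(f)$ denote the number of complex zeros of $f$, counted with multiplicity, in the open unit disk $\{|z|<1\}$ and on the unit circle $\{|z|=1\}$, respectively. Let $\mathcal L_n$ be the set of Littlewood polynomials of degree $n$, i.e. polynomials $a_0+a_1z+\dots+a_nz^n$ with all $a_j\in\{-1,1\}$, $0\le j\le n$. Let $m\ge 1$ and $l\ge 0$ be integers, and let $h$ be the polynomial of degree $l+3m$ whose sequence of coefficients $a_0,a_1,\dots,a_{l+3m}$ is given by the sign pattern $(+-+)^m+(-)^l$: $m$ copies of the block $+1,-1,+1$, then a single $+1$, then $l$ copies of $-1$. Then $h\in\mathcal L_{l+3m}$, and $$h(z)=(1-z+z^2)\cdot\frac{1-z^{3m}}{1-z^3}+z^{3m}-z^{3m+1}\cdot\frac{1-z^l}{1-z}\qquad(z\in\mathbb C,\ z^3\ne 1).$$ If $l\ne m+1$, then $U(h)=0$ and $$N(h)=\begin{cases}2m, & \text{if } l<m+1,\\ 2m+1, & \text{if } l>m+1.\end{cases}$$ -/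

import Mathlib

open Polynomial

/-- The polynomial `a₀ + a₁ X + ⋯ + aₙ Xⁿ` whose coefficients, in order of increasing power,
are the letters of the word `a₀ a₁ … aₙ`. -/
noncomputable def wordPoly (w : List ℤ) : ℤ[X] :=
  ∑ j ∈ Finset.range w.length, monomial j (w.getD j 0)

/-- The word `(+-+)^m + (-)^l`: `m` copies of the block `+-+`, then a single `+`, then `l`
copies of `-`. -/
def patternWord (m l : ℕ) : List ℤ :=
  (List.replicate m [1, -1, 1]).flatten ++ [1] ++ List.replicate l (-1)

/-- The Littlewood polynomials of degree `n`: all coefficients `a₀, …, aₙ` are `1` or `-1`. -/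
def littlewood (n : ℕ) : Set ℤ[X] :=
  {f | f.natDegree = n ∧ ∀ j ≤ n, f.coeff j = 1 ∨ f.coeff j = -1}

/-- `N(f)`: the number of complex zeros of `f` in the open unit disk, with multiplicity. -/
noncomputable def zerosInDisk (f : ℤ[X]) : ℕ :=
  ((f.aroots ℂ).filter (fun z => ‖z‖ < 1)).card

/-- `U(f)`: the number of complex zeros of `f` on the unit circle, with multiplicity. -/
noncomputable def zerosOnCircle (f : ℤ[X]) : ℕ :=
  ((f.aroots ℂ).filter (fun z => ‖z‖ = 1)).card

/-! Multiplying by 1 - z^3 collapses h to three terms: (1 - z + z^2) - 2z^(3m+2)(1 + z) +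
z^(3m+l+1)(1 + z + z^2) (`one_sub_cube_mul_aeval`). At z = e^(it), with k = cos(t/2), their moduli
are |4k^2 - 3|, 4|k| and |4k^2 - 1|. The cube roots of unity cut the circle into three arcs: inside
the two adjacent to 1 (|k| > 1/2) the middle term dominates, inside the opposite one (|k| < 1/2) the
first does. At the cube roots themselves h is evaluated directly; h(1) = m + 1 - l is where l ≠ m +
1 enters. Hence h has no zero on the circle.

N(h) comes from the argument principle. On each arc, c·h(e^(it))·e^(iκt), with c = ±i and κ chosen
to cancel the phase of the dominant term, stays in the closed right half-plane minus 0, so the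
principal logarithm gives an antiderivative of the logarithmic derivative. The explicit phases
contribute (4m+1)πi. The logarithms cancel at the two nonreal cube roots and leave at 1 a jump of
-πi or πi, according to the sign of m + 1 - l. Thus 2πN(h) is 4mπ or (4m+2)π. -/

/-! ### Word polynomials and closed forms of h. -/

theorem wordPoly_coeff (w : List ℤ) (j : ℕ) : (wordPoly w).coeff j = w.getD j 0 := by
  simp only [wordPoly, finsetSum_coeff, coeff_monomial, Finset.sum_ite_eq', Finset.mem_range]
  split_ifs with hj
  · rfl
  · rw [List.getD_eq_default _ _ (not_lt.mp hj)]

theorem wordPoly_nil : wordPoly [] = 0 := by simp [wordPoly]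

theorem wordPoly_cons (a : ℤ) (w : List ℤ) : wordPoly (a :: w) = C a + X * wordPoly w := by
  ext j
  cases j <;> simp [wordPoly_coeff, coeff_C, coeff_X_mul, -eq_intCast]

theorem wordPoly_append (u v : List ℤ) :
    wordPoly (u ++ v) = wordPoly u + X ^ u.length * wordPoly v := by
  induction u with
  | nil => simp [wordPoly_nil]
  | cons a u ih => simp only [List.cons_append, wordPoly_cons, ih, List.length_cons]; ring

theorem patternWord_length (m l : ℕ) : (patternWord m l).length = l + 3 * m + 1 := by
  simp [patternWord]; ring

theorem wordPoly_patternWord_mem_littlewood (m l : ℕ) :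
    wordPoly (patternWord m l) ∈ littlewood (l + 3 * m) := by
  have key : ∀ j ≤ l + 3 * m, (wordPoly (patternWord m l)).coeff j = 1 ∨
      (wordPoly (patternWord m l)).coeff j = -1 := by
    intro j hj
    have hj' : j < (patternWord m l).length := by rw [patternWord_length]; omega
    rw [wordPoly_coeff, List.getD_eq_getElem _ _ hj']
    have hmem := List.getElem_mem hj'
    generalize (patternWord m l)[j] = x at hmem
    simp only [patternWord, List.mem_append, List.mem_flatten, List.mem_replicate,
      List.mem_singleton] at hmem
    rcases hmem with (⟨b, ⟨-, rfl⟩, hx⟩ | hx) | hx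
    · simp at hx; tauto
    · exact Or.inl hx
    · exact Or.inr hx.2
  refine ⟨natDegree_eq_of_le_of_coeff_ne_zero ?_ ?_, key⟩
  · rw [natDegree_le_iff_coeff_eq_zero]
    intro j hj
    rw [wordPoly_coeff, List.getD_eq_default]
    rw [patternWord_length]; omega
  · rcases key _ le_rfl with h | h <;> rw [h] <;> norm_num

theorem aeval_wordPoly_flatten_replicate (m : ℕ) (z : ℂ) :
    aeval z (wordPoly (List.replicate m [1, -1, 1]).flatten) =
      (1 - z + z ^ 2) * ∑ i ∈ Finset.range m, (z ^ 3) ^ i := by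
  induction m with
  | zero => simp [wordPoly_nil]
  | succ m ih =>
    simp only [List.replicate_succ, List.flatten_cons, wordPoly_append, wordPoly_cons, wordPoly_nil,
      map_add, map_mul, ih, Finset.sum_range_succ', pow_succ (z ^ 3),
      ← Finset.sum_mul]
    simp
    ring

theorem aeval_wordPoly_replicate (l : ℕ) (z : ℂ) :
    aeval z (wordPoly (List.replicate l (-1))) = -∑ i ∈ Finset.range l, z ^ i := by
  induction l with
  | zero => simp [wordPoly_nil]
  | succ l ih =>
    simp only [List.replicate_succ, wordPoly_cons, map_add, map_mul, ih, Finset.sum_range_succ',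
      pow_succ z, ← Finset.sum_mul]
    simp
    ring

theorem aeval_wordPoly_patternWord (m l : ℕ) (z : ℂ) :
    aeval z (wordPoly (patternWord m l)) =
      (1 - z + z ^ 2) * ∑ i ∈ Finset.range m, (z ^ 3) ^ i + z ^ (3 * m)
        - z ^ (3 * m + 1) * ∑ i ∈ Finset.range l, z ^ i := by
  simp only [patternWord, wordPoly_append, map_add, map_mul, aeval_wordPoly_flatten_replicate,
    aeval_wordPoly_replicate]
  simp [wordPoly_cons, wordPoly_nil, mul_comm m 3]
  ring

theorem one_sub_cube_mul_aeval (m l : ℕ) (z : ℂ) :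
    (1 - z ^ 3) * aeval z (wordPoly (patternWord m l)) =
      (1 - z + z ^ 2) - 2 * z ^ (3 * m + 2) * (1 + z)
        + z ^ (3 * m + l + 1) * (1 + z + z ^ 2) := by
  rw [aeval_wordPoly_patternWord]
  have h1 := mul_neg_geom_sum (z ^ 3) m
  have h2 := mul_neg_geom_sum z l
  rw [← pow_mul] at h1
  linear_combination (1 - z + z ^ 2) * h1 - z ^ (3 * m + 1) * (1 + z + z ^ 2) * h2

theorem aeval_patternWord_of_cube_ne_one (m l : ℕ) (z : ℂ) (hz : z ^ 3 ≠ 1) :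
    aeval z (wordPoly (patternWord m l)) =
      (1 - z + z ^ 2) * ((1 - z ^ (3 * m)) / (1 - z ^ 3)) + z ^ (3 * m)
        - z ^ (3 * m + 1) * ((1 - z ^ l) / (1 - z)) := by
  have h3 : 1 - z ^ 3 ≠ 0 := sub_ne_zero.mpr hz.symm
  have h1 : 1 - z ≠ 0 := by
    intro h
    apply h3
    linear_combination (1 + z + z ^ 2) * h
  rw [aeval_wordPoly_patternWord, pow_mul z 3 m, ← mul_neg_geom_sum (z ^ 3) m,
    ← mul_neg_geom_sum z l, mul_div_cancel_left₀ _ h3, mul_div_cancel_left₀ _ h1]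

theorem aeval_one_patternWord (m l : ℕ) :
    aeval (1 : ℂ) (wordPoly (patternWord m l)) = ((m + 1 - l : ℝ) : ℂ) := by
  rw [aeval_wordPoly_patternWord]
  simp

theorem aeval_patternWord_ne_zero_of_cube_eq_one {m l : ℕ} (hl : l ≠ m + 1) {z : ℂ}
    (hz : z ^ 3 = 1) : aeval z (wordPoly (patternWord m l)) ≠ 0 := by
  by_cases h1 : z = 1
  · subst h1
    rw [aeval_one_patternWord, Complex.ofReal_ne_zero]
    intro h
    apply hl
    have : (l : ℝ) = m + 1 := by linarith
    exact_mod_cast this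
  have hq : z ^ 2 + z + 1 = 0 := by
    have : (z - 1) * (z ^ 2 + z + 1) = 0 := by linear_combination hz
    exact (mul_eq_zero.mp this).resolve_left (sub_ne_zero.mpr h1)
  -- For z a primitive cube root of unity, 1 - z + z^2 = -2z, so h(z) is 1 - 2mz, 1 - (2m+1)z or 2 -
  -- 2mz according to l mod 3. None vanishes, because az = b would make the positive form b^2 + ab +
  -- a^2 zero.
  have aux : ∀ a b : ℕ, b ≠ 0 → (a : ℂ) * z ≠ b := by
    intro a b hb h
    have : (b : ℂ) ^ 2 + a * b + a ^ 2 = 0 := by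
      linear_combination (-(b : ℂ) - a * z - a) * h + (a : ℂ) ^ 2 * hq
    have h' : b ^ 2 + a * b + a ^ 2 = 0 := by exact_mod_cast this
    have : 0 < b ^ 2 := by positivity
    omega
  intro h
  have hg := mul_neg_geom_sum z l
  have hl3 : z ^ l = z ^ (l % 3) := by
    conv_lhs => rw [← Nat.div_add_mod l 3, pow_add, pow_mul, hz, one_pow, one_mul]
  rw [hl3] at hg
  rw [aeval_wordPoly_patternWord, pow_succ z (3 * m), pow_mul, hz] at h
  simp only [one_pow, Finset.sum_const, Finset.card_range, nsmul_eq_mul, mul_one, one_mul] at h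
  have h1' : 1 - z ≠ 0 := sub_ne_zero.mpr (Ne.symm h1)
  have hcases : l % 3 = 0 ∨ l % 3 = 1 ∨ l % 3 = 2 := by omega
  rcases hcases with hr | hr | hr <;> rw [hr] at hg
  · apply aux (2 * m) 1 one_ne_zero
    apply mul_left_cancel₀ h1'
    push_cast
    linear_combination (z - 1) * h - z * hg + (1 - z) * m * hq
  · apply aux (2 * m + 1) 1 one_ne_zero
    apply mul_left_cancel₀ h1'
    push_cast
    linear_combination (z - 1) * h - z * hg + (1 - z) * m * hq
  · apply aux (2 * m) 2 two_ne_zero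
    apply mul_left_cancel₀ h1'
    push_cast
    linear_combination (z - 1) * h - z * hg + (1 - z) * m * hq + hz

/-! ### The argument principle on the unit circle, and its evaluation along arcs. -/

theorem circleIntegral_sub_inv_of_one_lt_norm {w : ℂ} (hw : 1 < ‖w‖) :
    (∮ z in C(0, 1), (z - w)⁻¹) = 0 := by
  have hne : ∀ z ∈ Metric.closedBall (0 : ℂ) 1, z - w ≠ 0 := by
    intro z hz h
    rw [mem_closedBall_zero_iff, sub_eq_zero.mp h] at hz
    linarith
  refine Complex.circleIntegral_eq_zero_of_differentiable_on_off_countable zero_le_one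
    Set.countable_empty ?_ ?_
  · exact fun z hz => ((continuousAt_id.sub continuousAt_const).inv₀ (hne z hz)).continuousWithinAt
  · intro z hz
    exact ((differentiableAt_id.sub_const w).inv (hne z (Metric.ball_subset_closedBall hz.1)))

theorem circleIntegral_sum_sub_inv (s : Multiset ℂ) (hs : ∀ r ∈ s, ‖r‖ ≠ 1) :
    CircleIntegrable (fun z => (s.map fun r => 1 / (z - r)).sum) 0 1 ∧
      (∮ z in C(0, 1), (s.map fun r => 1 / (z - r)).sum) =
        2 * Real.pi * Complex.I * (s.filter fun r => ‖r‖ < 1).card := by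
  induction s using Multiset.induction_on with
  | empty => simp [circleIntegral]
  | cons a s ih =>
    obtain ⟨ih1, ih2⟩ := ih fun r hr => hs r (Multiset.mem_cons_of_mem hr)
    have ha : ‖a‖ ≠ 1 := hs a (Multiset.mem_cons_self a s)
    have hi : CircleIntegrable (fun z => 1 / (z - a)) 0 1 := by
      simp only [one_div]
      rw [circleIntegrable_sub_inv_iff]
      right
      simpa using ha
    simp only [Multiset.map_cons, Multiset.sum_cons]
    refine ⟨hi.add ih1, ?_⟩
    rw [circleIntegral.integral_add hi ih1, ih2]
    simp only [one_div]
    rcases lt_or_gt_of_ne ha with h | h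
    · rw [circleIntegral.integral_sub_inv_of_mem_ball (by simpa using h),
        Multiset.filter_cons_of_pos (p := fun r : ℂ => ‖r‖ < 1) s h, Multiset.card_cons]
      push_cast
      ring
    · rw [circleIntegral_sub_inv_of_one_lt_norm h, 
        Multiset.filter_cons_of_neg (p := fun r : ℂ => ‖r‖ < 1) s (not_lt.mpr h.le), zero_add]

theorem integral_logDeriv_unit_circle (q : ℂ[X]) (hq : ∀ z : ℂ, ‖z‖ = 1 → q.eval z ≠ 0) :
    (∫ t in (0 : ℝ)..2 * Real.pi, Complex.exp (t * Complex.I) * Complex.I *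
        (q.derivative.eval (Complex.exp (t * Complex.I)) / q.eval (Complex.exp (t * Complex.I)))) =
      2 * Real.pi * Complex.I * (q.roots.filter fun r => ‖r‖ < 1).card := by
  have hr : ∀ r ∈ q.roots, ‖r‖ ≠ 1 := fun r hr h => hq r h (isRoot_of_mem_roots hr)
  rw [← (circleIntegral_sum_sub_inv q.roots hr).2, circleIntegral]
  refine intervalIntegral.integral_congr fun t _ => ?_
  have ht := hq _ (Complex.norm_exp_ofReal_mul_I t)
  simp only [deriv_circleMap, circleMap_zero, Complex.ofReal_one, one_mul, smul_eq_mul]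
  rw [(IsAlgClosed.splits q).eval_derivative_div_eval_of_ne_zero ht]

/-- The factor e^(ikt) keeps the curve off the branch cut; its own logarithmic derivative ik is what
the last term subtracts. -/
theorem integral_logDeriv_arc (q : ℂ[X]) (c : ℂ) (k a b : ℝ) (hab : a ≤ b)
    (hs : ∀ t ∈ Set.Icc a b, c * q.eval (Complex.exp (t * Complex.I)) *
      Complex.exp (k * t * Complex.I) ∈ Complex.slitPlane) :
    (∫ t in a..b, Complex.exp (t * Complex.I) * Complex.I *
        (q.derivative.eval (Complex.exp (t * Complex.I)) / q.eval (Complex.exp (t * Complex.I)))) =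
      Complex.log (c * q.eval (Complex.exp (b * Complex.I)) * Complex.exp (k * b * Complex.I))
      - Complex.log (c * q.eval (Complex.exp (a * Complex.I)) * Complex.exp (k * a * Complex.I))
      - k * (b - a) * Complex.I := by
  have hne : ∀ t ∈ Set.Icc a b, c ≠ 0 ∧ q.eval (Complex.exp (t * Complex.I)) ≠ 0 := by
    intro t ht
    have := Complex.slitPlane_ne_zero (hs t ht)
    exact ⟨left_ne_zero_of_mul (left_ne_zero_of_mul this),
      right_ne_zero_of_mul (left_ne_zero_of_mul this)⟩
  have hexp : ∀ t : ℝ, HasDerivAt (fun t : ℝ => Complex.exp (t * Complex.I))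
      (Complex.exp (t * Complex.I) * Complex.I) t := by
    intro t
    simpa using ((Complex.ofRealCLM.hasDerivAt (x := t)).mul_const Complex.I).cexp
  have hexpk : ∀ t : ℝ, HasDerivAt (fun t : ℝ => Complex.exp (k * t * Complex.I))
      (Complex.exp (k * t * Complex.I) * (k * Complex.I)) t := by
    intro t
    simpa using (((Complex.ofRealCLM.hasDerivAt (x := t)).const_mul (k : ℂ)).mul_const
      Complex.I).cexp
  have hlin : ∀ t : ℝ, HasDerivAt (fun t : ℝ => (k : ℂ) * t * Complex.I) (k * Complex.I) t := by
    intro t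
    simpa using ((Complex.ofRealCLM.hasDerivAt (x := t)).const_mul (k : ℂ)).mul_const Complex.I
  have hder : ∀ t ∈ Set.uIcc a b, HasDerivAt (fun t : ℝ =>
      Complex.log (c * q.eval (Complex.exp (t * Complex.I)) * Complex.exp (k * t * Complex.I))
        - k * t * Complex.I)
      (Complex.exp (t * Complex.I) * Complex.I *
        (q.derivative.eval (Complex.exp (t * Complex.I)) /
          q.eval (Complex.exp (t * Complex.I)))) t := by
    intro t ht
    rw [Set.uIcc_of_le hab] at ht
    obtain ⟨hc, hq⟩ := hne t ht
    have hcomp : HasDerivAt (fun t : ℝ => q.eval (Complex.exp (t * Complex.I)))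
        (q.derivative.eval (Complex.exp (t * Complex.I)) *
          (Complex.exp (t * Complex.I) * Complex.I)) t :=
      HasDerivAt.comp t (h₂ := fun z => q.eval z) (q.hasDerivAt _) (hexp t)
    refine ((((hcomp.const_mul c).mul (hexpk t)).clog_real (hs t ht)).sub (hlin t)).congr_deriv ?_
    have := Complex.exp_ne_zero (k * t * Complex.I)
    simp only [Pi.mul_apply]
    field_simp
    ring
  rw [intervalIntegral.integral_eq_sub_of_hasDerivAt hder]
  · ring
  · refine ContinuousOn.intervalIntegrable ?_
    rw [Set.uIcc_of_le hab]
    have he : Continuous fun t : ℝ => Complex.exp (t * Complex.I) := by fun_prop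
    refine (he.mul continuous_const).continuousOn.mul (ContinuousOn.div ?_ ?_ fun t ht => (hne t ht).2)
    · exact (q.derivative.continuous.comp he).continuousOn
    · exact (q.continuous.comp he).continuousOn

/-- By continuity the real part is still nonnegative at the endpoints, and the closed right
half-plane meets the complement of the slit plane only at 0. -/
theorem mem_slitPlane_of_re_pos_on_Ioo {f : ℝ → ℂ} {a b : ℝ} (hab : a < b) (hf : Continuous f)
    (hpos : ∀ t ∈ Set.Ioo a b, 0 < (f t).re) (ha : f a ≠ 0) (hb : f b ≠ 0) :
    ∀ t ∈ Set.Icc a b, f t ∈ Complex.slitPlane := by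
  intro t ht
  have hre : 0 ≤ (f t).re := by
    have hcl : IsClosed {t | 0 ≤ (f t).re} :=
      isClosed_le continuous_const (Complex.continuous_re.comp hf)
    have := closure_minimal (fun t ht => (hpos t ht).le) hcl
    rw [closure_Ioo hab.ne] at this
    exact this ht
  have hne : f t ≠ 0 := by
    rcases eq_or_lt_of_le ht.1 with rfl | h1
    · exact ha
    rcases eq_or_lt_of_le ht.2 with rfl | h2
    · exact hb
    intro h
    have := hpos t ⟨h1, h2⟩
    simp [h] at this
  rw [Complex.mem_slitPlane_iff]
  rcases hre.eq_or_lt with h | h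
  · exact Or.inr fun him => hne (Complex.ext h.symm him)
  · exact Or.inl h

/-! ### Half-angle form of h on the circle and the dominant term. -/

theorem abs_mul_re_le_abs_of_norm_eq_one (x : ℝ) {u : ℂ} (hu : ‖u‖ = 1) :
    |x * u.re| ≤ |x| := by
  rw [abs_mul]
  exact mul_le_of_le_one_right (abs_nonneg x) (hu ▸ Complex.abs_re_le_norm u)

theorem trig_factorisations (t : ℝ) :
    let s := Complex.exp (t / 2 * Complex.I)
    let k : ℂ := (Real.cos (t / 2) : ℝ)
    let z := Complex.exp (t * Complex.I)
    z = s ^ 2 ∧ 1 - z + z ^ 2 = s ^ 2 * (4 * k ^ 2 - 3) ∧ 1 + z = 2 * s * k ∧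
      1 + z + z ^ 2 = s ^ 2 * (4 * k ^ 2 - 1) ∧
      1 - z ^ 3 = -2 * Complex.I * (Real.sin (3 * t / 2) : ℝ) * s ^ 3 := by
  intro s k z
  have hz : z = s ^ 2 := by
    simp only [z, s, ← Complex.exp_nat_mul]
    congr 1
    push_cast
    ring
  have hs : s ≠ 0 := Complex.exp_ne_zero _
  have hk : k = (s + s⁻¹) / 2 := by
    simp only [k, s, Complex.ofReal_cos, Complex.cos, ← Complex.exp_neg]
    push_cast
    ring_nf
  have hσ : ((Real.sin (3 * t / 2) : ℝ) : ℂ) = (s⁻¹ ^ 3 - s ^ 3) * Complex.I / 2 := by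
    simp only [s, Complex.ofReal_sin, Complex.sin, ← Complex.exp_neg, ← Complex.exp_nat_mul]
    push_cast
    ring_nf
  refine ⟨hz, ?_, ?_, ?_, ?_⟩
  · rw [hz, hk]
    field_simp
    ring
  · rw [hz, hk]
    field_simp
    ring
  · rw [hz, hk]
    field_simp
    ring
  · rw [hz, hσ]
    field_simp
    linear_combination (1 - s ^ 6) * Complex.I_sq

/-- Dividing by s^(6m+5), where s = e^(it/2), makes the dominant term -2z^(3m+2)(1 + z) real. -/
theorem arc_identity_outer (m l : ℕ) (t : ℝ) :
    ((-2 * Real.sin (3 * t / 2) : ℝ) : ℂ) * (Complex.I *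
        aeval (Complex.exp (t * Complex.I)) (wordPoly (patternWord m l)) *
        Complex.exp ((-(3 * m + 1) : ℝ) * t * Complex.I)) =
      (4 * Real.cos (t / 2) ^ 2 - 3 : ℝ) * Complex.exp ((-(3 * m + 3 / 2) * t : ℝ) * Complex.I)
        - (4 * Real.cos (t / 2) : ℝ)
        + (4 * Real.cos (t / 2) ^ 2 - 1 : ℝ) * Complex.exp (((l - 1 / 2) * t : ℝ) * Complex.I) := by
  obtain ⟨hz, h1, h2, h3, h4⟩ := trig_factorisations t
  have key := one_sub_cube_mul_aeval m l (Complex.exp (t * Complex.I))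
  rw [h4, h3, h2, h1] at key
  generalize aeval (Complex.exp (t * Complex.I)) (wordPoly (patternWord m l)) = H at key ⊢
  rw [hz] at key
  set s := Complex.exp (t / 2 * Complex.I)
  have hs : s ≠ 0 := Complex.exp_ne_zero _
  have e1 : Complex.exp ((-(3 * m + 1) : ℝ) * t * Complex.I) = (s ^ (6 * m + 2))⁻¹ := by
    rw [← Complex.exp_nat_mul, ← Complex.exp_neg]
    congr 1
    push_cast
    ring
  have e2 : Complex.exp ((-(3 * m + 3 / 2) * t : ℝ) * Complex.I) = (s ^ (6 * m + 3))⁻¹ := by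
    rw [← Complex.exp_nat_mul, ← Complex.exp_neg]
    congr 1
    push_cast
    ring
  have e3 : Complex.exp (((l - 1 / 2) * t : ℝ) * Complex.I) = s ^ (2 * l) * s⁻¹ := by
    rw [← Complex.exp_nat_mul, ← Complex.exp_neg, ← Complex.exp_add]
    congr 1
    push_cast
    ring
  rw [e1, e2, e3]
  push_cast at key ⊢
  apply mul_left_cancel₀ (pow_ne_zero (6 * m + 5) hs)
  have c1 : s ^ (6 * m + 5) * (s ^ (6 * m + 2))⁻¹ = s ^ 3 := by field_simp; ring
  have c2 : s ^ (6 * m + 5) * (s ^ (6 * m + 3))⁻¹ = s ^ 2 := by field_simp; ring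
  have c3 : s ^ (6 * m + 5) * (s ^ (2 * l) * s⁻¹) = s ^ (6 * m + 2 * l + 4) := by field_simp; ring
  linear_combination key - 2 * Complex.sin (3 * t / 2) * Complex.I * H * c1
    - (4 * Complex.cos (t / 2) ^ 2 - 3) * c2 - (4 * Complex.cos (t / 2) ^ 2 - 1) * c3

/-- Here the division is by s^2, which makes the dominant term 1 - z + z^2 real. -/
theorem arc_identity_inner (m l : ℕ) (t : ℝ) :
    ((2 * Real.sin (3 * t / 2) : ℝ) : ℂ) * (-Complex.I *
        aeval (Complex.exp (t * Complex.I)) (wordPoly (patternWord m l)) *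
        Complex.exp ((1 / 2 : ℝ) * t * Complex.I)) =
      (4 * Real.cos (t / 2) ^ 2 - 3 : ℝ)
        - (4 * Real.cos (t / 2) : ℝ) * Complex.exp (((3 * m + 3 / 2) * t : ℝ) * Complex.I)
        + (4 * Real.cos (t / 2) ^ 2 - 1 : ℝ) *
          Complex.exp (((3 * m + l + 1) * t : ℝ) * Complex.I) := by
  obtain ⟨hz, h1, h2, h3, h4⟩ := trig_factorisations t
  have key := one_sub_cube_mul_aeval m l (Complex.exp (t * Complex.I))
  rw [h4, h3, h2, h1] at key
  generalize aeval (Complex.exp (t * Complex.I)) (wordPoly (patternWord m l)) = H at key ⊢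
  rw [hz] at key
  have e1 : Complex.exp ((1 / 2 : ℝ) * t * Complex.I) = Complex.exp (t / 2 * Complex.I) := by
    congr 1
    push_cast
    ring
  have e2 : Complex.exp (((3 * m + 3 / 2) * t : ℝ) * Complex.I) =
      Complex.exp (t / 2 * Complex.I) ^ (6 * m + 3) := by
    rw [← Complex.exp_nat_mul]
    congr 1
    push_cast
    ring
  have e3 : Complex.exp (((3 * m + l + 1) * t : ℝ) * Complex.I) =
      Complex.exp (t / 2 * Complex.I) ^ (6 * m + 2 * l + 2) := by
    rw [← Complex.exp_nat_mul]
    congr 1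
    push_cast
    ring
  rw [e1, e2, e3]
  set s := Complex.exp (t / 2 * Complex.I)
  have hs : s ≠ 0 := Complex.exp_ne_zero _
  push_cast at key ⊢
  apply mul_left_cancel₀ (pow_ne_zero 2 hs)
  linear_combination key

/-- The left side is 2 or 8k^2 - 4, according to the sign of 4k^2 - 3. Equality would occur only at
|k| = 1/2 and |k| = 1, the cube roots of unity. -/
theorem abs_add_abs_lt_four_mul_abs {k : ℝ} (h1 : 1 / 2 < |k|) (h2 : |k| < 1) :
    |4 * k ^ 2 - 3| + |4 * k ^ 2 - 1| < 4 * |k| := by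
  rw [← sq_abs k]
  generalize |k| = x at *
  rcases abs_cases (4 * x ^ 2 - 3) with h | h <;> rcases abs_cases (4 * x ^ 2 - 1) with h' | h' <;>
    nlinarith

theorem four_mul_abs_add_abs_lt {k : ℝ} (h : |k| < 1 / 2) :
    4 * |k| + |4 * k ^ 2 - 1| < 3 - 4 * k ^ 2 := by
  have h0 := abs_nonneg k
  rw [← sq_abs k]
  generalize |k| = x at *
  rw [abs_of_nonpos (by nlinarith)]
  linarith

theorem abs_add_lt_of_outer (m l : ℕ) {t : ℝ} (h1 : 1 / 2 < |Real.cos (t / 2)|)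
    (h2 : |Real.cos (t / 2)| < 1) :
    |-2 * Real.sin (3 * t / 2) * (Complex.I *
        aeval (Complex.exp (t * Complex.I)) (wordPoly (patternWord m l)) *
        Complex.exp ((-(3 * m + 1) : ℝ) * t * Complex.I)).re + 4 * Real.cos (t / 2)| <
      4 * |Real.cos (t / 2)| := by
  have h := congrArg Complex.re (arc_identity_outer m l t)
  simp only [Complex.add_re, Complex.sub_re, Complex.re_ofReal_mul, Complex.ofReal_re] at h
  rw [h]
  refine lt_of_le_of_lt ?_ (abs_add_abs_lt_four_mul_abs h1 h2)
  have b1 := abs_mul_re_le_abs_of_norm_eq_one (4 * Real.cos (t / 2) ^ 2 - 3)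
    (Complex.norm_exp_ofReal_mul_I (-(3 * m + 3 / 2) * t))
  have b2 := abs_mul_re_le_abs_of_norm_eq_one (4 * Real.cos (t / 2) ^ 2 - 1)
    (Complex.norm_exp_ofReal_mul_I ((l - 1 / 2) * t))
  refine le_trans (le_of_eq ?_) ((abs_add_le _ _).trans (add_le_add b1 b2))
  ring_nf

theorem re_neg_of_inner (m l : ℕ) {t : ℝ} (h1 : |Real.cos (t / 2)| < 1 / 2) :
    2 * Real.sin (3 * t / 2) * (-Complex.I *
        aeval (Complex.exp (t * Complex.I)) (wordPoly (patternWord m l)) *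
        Complex.exp ((1 / 2 : ℝ) * t * Complex.I)).re < 0 := by
  have h := congrArg Complex.re (arc_identity_inner m l t)
  simp only [Complex.add_re, Complex.sub_re, Complex.re_ofReal_mul, Complex.ofReal_re] at h
  rw [h]
  have b1 := abs_le.mp (abs_mul_re_le_abs_of_norm_eq_one (4 * Real.cos (t / 2))
    (Complex.norm_exp_ofReal_mul_I ((3 * m + 3 / 2) * t)))
  have b2 := abs_le.mp (abs_mul_re_le_abs_of_norm_eq_one (4 * Real.cos (t / 2) ^ 2 - 1)
    (Complex.norm_exp_ofReal_mul_I ((3 * m + l + 1) * t)))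
  have b3 := four_mul_abs_add_abs_lt h1
  rw [abs_mul, abs_of_pos (by norm_num : (0 : ℝ) < 4)] at b1
  linarith [b1.1, b2.2]

theorem exp_two_pi_div_three_cube (j : ℕ) :
    Complex.exp ((j * (2 * Real.pi / 3) : ℝ) * Complex.I) ^ 3 = 1 := by
  rw [← Complex.exp_nat_mul, Complex.exp_eq_one_iff]
  refine ⟨j, ?_⟩
  push_cast
  ring

/-! ### Nonvanishing on the three arcs. -/

section Arcs

open Real

variable {m l : ℕ} (hl : l ≠ m + 1)
include hl

theorem arc_ne_zero {c : ℂ} (hc : c ≠ 0) (w : ℂ) {t : ℝ} (j : ℕ) (ht : t = j * (2 * π / 3)) :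
    c * aeval (Complex.exp (t * Complex.I)) (wordPoly (patternWord m l)) * Complex.exp w ≠ 0 := by
  refine mul_ne_zero (mul_ne_zero hc ?_) (Complex.exp_ne_zero w)
  apply aeval_patternWord_ne_zero_of_cube_eq_one hl
  rw [ht, exp_two_pi_div_three_cube]

theorem first_arc_mem_slitPlane : ∀ t ∈ Set.Icc 0 (2 * π / 3), Complex.I *
      aeval (Complex.exp (t * Complex.I)) (wordPoly (patternWord m l)) *
      Complex.exp ((-(3 * m + 1) : ℝ) * t * Complex.I) ∈ Complex.slitPlane := by
  have hpi := pi_pos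
  refine mem_slitPlane_of_re_pos_on_Ioo (by positivity) (by fun_prop) ?_
    (arc_ne_zero hl Complex.I_ne_zero _ 0 (by simp))
    (arc_ne_zero hl Complex.I_ne_zero _ 1 (by simp))
  rintro t ⟨h0, h1⟩
  have hs : 0 < sin (3 * t / 2) := sin_pos_of_pos_of_lt_pi (by linarith) (by linarith)
  have hc1 : 1 / 2 < cos (t / 2) := by
    rw [← cos_pi_div_three]
    exact cos_lt_cos_of_nonneg_of_le_pi (by linarith) (by linarith) (by linarith)
  have hc2 : cos (t / 2) < 1 := by
    rw [← cos_zero]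
    exact cos_lt_cos_of_nonneg_of_le_pi le_rfl (by linarith) (by linarith)
  have habs : |cos (t / 2)| = cos (t / 2) := abs_of_pos (by linarith)
  have := (abs_lt.mp (abs_add_lt_of_outer m l (t := t) (by rwa [habs]) (by rwa [habs]))).2
  rw [habs] at this
  exact pos_of_mul_pos_right (by linarith) hs.le

theorem second_arc_mem_slitPlane : ∀ t ∈ Set.Icc (2 * π / 3) (4 * π / 3), -Complex.I *
      aeval (Complex.exp (t * Complex.I)) (wordPoly (patternWord m l)) *
      Complex.exp ((1 / 2 : ℝ) * t * Complex.I) ∈ Complex.slitPlane := by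
  have hpi := pi_pos
  refine mem_slitPlane_of_re_pos_on_Ioo (by linarith) (by fun_prop) ?_
    (arc_ne_zero hl (neg_ne_zero.mpr Complex.I_ne_zero) _ 1 (by simp))
    (arc_ne_zero hl (neg_ne_zero.mpr Complex.I_ne_zero) _ 2 (by push_cast; ring))
  rintro t ⟨h0, h1⟩
  have hs : sin (3 * t / 2) < 0 := by
    have : 0 < sin (3 * t / 2 - π) := sin_pos_of_pos_of_lt_pi (by linarith) (by linarith)
    rw [sin_sub_pi] at this
    linarith
  have hc1 : cos (t / 2) < 1 / 2 := by
    rw [← cos_pi_div_three]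
    exact cos_lt_cos_of_nonneg_of_le_pi (by linarith) (by linarith) (by linarith)
  have hc2 : -(1 / 2) < cos (t / 2) := by
    rw [← cos_pi_div_three, ← cos_pi_sub]
    exact cos_lt_cos_of_nonneg_of_le_pi (by linarith) (by linarith) (by linarith)
  have := re_neg_of_inner m l (t := t) (abs_lt.mpr ⟨hc2, hc1⟩)
  exact pos_of_mul_neg_right this (by linarith)

theorem third_arc_mem_slitPlane : ∀ t ∈ Set.Icc (4 * π / 3) (2 * π), -Complex.I *
      aeval (Complex.exp (t * Complex.I)) (wordPoly (patternWord m l)) *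
      Complex.exp ((-(3 * m + 1) : ℝ) * t * Complex.I) ∈ Complex.slitPlane := by
  have hpi := pi_pos
  refine mem_slitPlane_of_re_pos_on_Ioo (by linarith) (by fun_prop) ?_
    (arc_ne_zero hl (neg_ne_zero.mpr Complex.I_ne_zero) _ 2 (by push_cast; ring))
    (arc_ne_zero hl (neg_ne_zero.mpr Complex.I_ne_zero) _ 3 (by push_cast; ring))
  rintro t ⟨h0, h1⟩
  have hs : 0 < sin (3 * t / 2) := by
    rw [← sin_sub_two_pi]
    exact sin_pos_of_pos_of_lt_pi (by linarith) (by linarith)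
  have hc1 : cos (t / 2) < -(1 / 2) := by
    rw [← cos_pi_div_three, ← cos_pi_sub]
    exact cos_lt_cos_of_nonneg_of_le_pi (by linarith) (by linarith) (by linarith)
  have hc2 : -1 < cos (t / 2) := by
    rw [← cos_pi]
    exact cos_lt_cos_of_nonneg_of_le_pi (by linarith) (by linarith) (by linarith)
  have habs : |cos (t / 2)| = -cos (t / 2) := abs_of_neg (by linarith)
  have := (abs_lt.mp (abs_add_lt_of_outer m l (t := t) (by rw [habs]; linarith)
    (by rw [habs]; linarith))).1
  rw [habs] at this
  rw [neg_mul, neg_mul, Complex.neg_re, neg_pos]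
  exact neg_of_mul_pos_right (a := -2 * sin (3 * t / 2)) (by linarith) (by linarith)

theorem aeval_patternWord_ne_zero_of_norm_eq_one {z : ℂ} (hz : ‖z‖ = 1) :
    aeval z (wordPoly (patternWord m l)) ≠ 0 := by
  obtain ⟨t, ⟨ht0, ht1⟩, rfl⟩ : ∃ t ∈ Set.Icc 0 (2 * π), Complex.exp (t * Complex.I) = z := by
    have hexp : Complex.exp (z.arg * Complex.I) = z := by
      simpa [hz] using Complex.norm_mul_exp_arg_mul_I z
    have := Complex.neg_pi_lt_arg z
    have := Complex.arg_le_pi z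
    rcases le_or_gt 0 z.arg with h | h
    · exact ⟨z.arg, ⟨h, by linarith⟩, hexp⟩
    · refine ⟨z.arg + 2 * π, ⟨by linarith, by linarith⟩, ?_⟩
      push_cast
      rw [add_mul, Complex.exp_add, Complex.exp_two_pi_mul_I, mul_one, hexp]
  have aux : ∀ {c H w : ℂ}, c * H * w ∈ Complex.slitPlane → H ≠ 0 := fun h =>
    right_ne_zero_of_mul (left_ne_zero_of_mul (Complex.slitPlane_ne_zero h))
  rcases le_or_gt t (2 * π / 3) with h1 | h1
  · exact aux (first_arc_mem_slitPlane hl t ⟨ht0, h1⟩)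
  rcases le_or_gt t (4 * π / 3) with h2 | h2
  · exact aux (second_arc_mem_slitPlane hl t ⟨h1.le, h2⟩)
  · exact aux (third_arc_mem_slitPlane hl t ⟨h2.le, ht1⟩)

end Arcs

/-! ### The jump of the logarithm at 1 and the zero count. -/

theorem log_neg_I_mul_sub_log_I_mul_of_pos {r : ℝ} (hr : 0 < r) :
    Complex.log (-Complex.I * r) - Complex.log (Complex.I * r) = -(Real.pi * Complex.I) := by
  rw [mul_comm, mul_comm Complex.I, Complex.log_ofReal_mul hr (neg_ne_zero.mpr Complex.I_ne_zero),
    Complex.log_ofReal_mul hr Complex.I_ne_zero, Complex.log_neg_I, Complex.log_I]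
  ring

theorem log_neg_I_mul_sub_log_I_mul_of_neg {r : ℝ} (hr : r < 0) :
    Complex.log (-Complex.I * r) - Complex.log (Complex.I * r) = Real.pi * Complex.I := by
  have h := log_neg_I_mul_sub_log_I_mul_of_pos (neg_pos.mpr hr)
  push_cast at h
  rw [neg_mul_neg, mul_neg, ← neg_mul] at h
  linear_combination -h

theorem zerosOnCircle_patternWord {m l : ℕ} (hl : l ≠ m + 1) :
    zerosOnCircle (wordPoly (patternWord m l)) = 0 := by
  rw [zerosOnCircle, Multiset.card_eq_zero, Multiset.filter_eq_nil]
  intro z hz h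
  exact aeval_patternWord_ne_zero_of_norm_eq_one hl h (mem_aroots'.mp hz).2

theorem two_pi_I_mul_zerosInDisk {m l : ℕ} (hl : l ≠ m + 1) :
    2 * Real.pi * Complex.I * zerosInDisk (wordPoly (patternWord m l)) =
      Complex.log (-Complex.I * (m + 1 - l : ℝ)) - Complex.log (Complex.I * (m + 1 - l : ℝ)) +
        (4 * m + 1) * Real.pi * Complex.I := by
  have hpi := Real.pi_pos
  set q : ℂ[X] := (wordPoly (patternWord m l)).map (algebraMap ℤ ℂ) with hqdef
  have hev : ∀ z : ℂ, aeval z (wordPoly (patternWord m l)) = q.eval z := fun z =>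
    (eval_map_algebraMap _ z).symm
  have hq : ∀ z : ℂ, ‖z‖ = 1 → q.eval z ≠ 0 := fun z hz =>
    hev z ▸ aeval_patternWord_ne_zero_of_norm_eq_one hl hz
  have hN := integral_logDeriv_unit_circle q hq
  have h1 := integral_logDeriv_arc q Complex.I (-(3 * m + 1)) 0 (2 * Real.pi / 3) (by positivity)
    (by simpa only [hev] using first_arc_mem_slitPlane hl)
  have h2 := integral_logDeriv_arc q (-Complex.I) (1 / 2) (2 * Real.pi / 3) (4 * Real.pi / 3)
    (by linarith) (by simpa only [hev] using second_arc_mem_slitPlane hl)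
  have h3 := integral_logDeriv_arc q (-Complex.I) (-(3 * m + 1)) (4 * Real.pi / 3) (2 * Real.pi)
    (by linarith) (by simpa only [hev] using third_arc_mem_slitPlane hl)
  have hint : ∀ a b : ℝ, IntervalIntegrable (fun t : ℝ => Complex.exp (t * Complex.I) * Complex.I *
      (q.derivative.eval (Complex.exp (t * Complex.I)) / q.eval (Complex.exp (t * Complex.I))))
      MeasureTheory.volume a b := by
    intro a b
    refine Continuous.intervalIntegrable ?_ a b
    have he : Continuous fun t : ℝ => Complex.exp (t * Complex.I) := by fun_prop
    exact (he.mul continuous_const).mul ((q.derivative.continuous.comp he).div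
      (q.continuous.comp he) fun t => hq _ (Complex.norm_exp_ofReal_mul_I t))
  rw [← intervalIntegral.integral_add_adjacent_intervals (hint 0 (4 * Real.pi / 3)) (hint _ _),
    ← intervalIntegral.integral_add_adjacent_intervals (hint 0 (2 * Real.pi / 3)) (hint _ _),
    h1, h2, h3] at hN
  have hone : q.eval 1 = ((m + 1 - l : ℝ) : ℂ) := by rw [← hev, aeval_one_patternWord]
  have hN' : (zerosInDisk (wordPoly (patternWord m l)) : ℂ) =
    ((q.roots.filter fun r => ‖r‖ < 1).card : ℂ) := rfl
  have e0 : Complex.exp ((0 : ℝ) * Complex.I) = 1 := by simp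
  have e0' : Complex.exp ((-(3 * m + 1) : ℝ) * (0 : ℝ) * Complex.I) = 1 := by simp
  have e3 : Complex.exp ((2 * Real.pi : ℝ) * Complex.I) = 1 := by
    push_cast
    exact Complex.exp_two_pi_mul_I
  have e3' : Complex.exp ((-(3 * m + 1) : ℝ) * (2 * Real.pi : ℝ) * Complex.I) = 1 := by
    rw [Complex.exp_eq_one_iff]
    refine ⟨-(3 * m + 1), ?_⟩
    push_cast
    ring
  -- `e1` and `e2` say that the rotations of neighbouring arcs agree at the junctions t = 2π/3 and t
  -- = 4π/3, so the logarithms there cancel. The first uses e^(-2πi/3) = -e^(πi/3), which accounts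
  -- for the change from i to -i.
  have e1 : Complex.I * Complex.exp ((-(3 * m + 1) : ℝ) * (2 * Real.pi / 3 : ℝ) * Complex.I) =
      -Complex.I * Complex.exp ((1 / 2 : ℝ) * (2 * Real.pi / 3 : ℝ) * Complex.I) := by
    rw [neg_mul, ← mul_neg, ← mul_neg_one (Complex.exp _), ← Complex.exp_pi_mul_I,
      ← Complex.exp_add]
    congr 1
    rw [Complex.exp_eq_exp_iff_exists_int]
    refine ⟨-(m + 1), ?_⟩
    push_cast
    ring
  have e2 : Complex.exp ((-(3 * m + 1) : ℝ) * (4 * Real.pi / 3 : ℝ) * Complex.I) =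
      Complex.exp ((1 / 2 : ℝ) * (4 * Real.pi / 3 : ℝ) * Complex.I) := by
    rw [Complex.exp_eq_exp_iff_exists_int]
    refine ⟨-(2 * m + 1), ?_⟩
    push_cast
    ring
  rw [e0, e0', e3, e3', e2, mul_right_comm Complex.I _ (Complex.exp (_ * (2 * Real.pi / 3 : ℝ) * _)),
    e1, mul_right_comm (-Complex.I) (Complex.exp _) (eval _ q), hone, mul_one, mul_one] at hN
  -- The linear terms sum to (2π/3)(2(3m+1) - 1/2) = (4m+1)π, times i.
  rw [hN', ← hN]
  push_cast
  ring

theorem theorem2p8 (m l : ℕ) (hm : 1 ≤ m) (h : ℤ[X]) (hh : h = wordPoly (patternWord m l)) :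
    h ∈ littlewood (l + 3 * m) ∧
    (∀ z : ℂ, z ^ 3 ≠ 1 →
      aeval z h = (1 - z + z ^ 2) * ((1 - z ^ (3 * m)) / (1 - z ^ 3)) + z ^ (3 * m)
        - z ^ (3 * m + 1) * ((1 - z ^ l) / (1 - z))) ∧
    (l ≠ m + 1 →
      zerosOnCircle h = 0 ∧
      (l < m + 1 → zerosInDisk h = 2 * m) ∧
      (m + 1 < l → zerosInDisk h = 2 * m + 1)) := by
  subst hh
  refine ⟨wordPoly_patternWord_mem_littlewood m l, aeval_patternWord_of_cube_ne_one m l,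
    fun hl => ⟨zerosOnCircle_patternWord hl, fun hlt => ?_, fun hlt => ?_⟩⟩
  all_goals
    have key := two_pi_I_mul_zerosInDisk hl
    have hpi : (2 * Real.pi * Complex.I : ℂ) ≠ 0 := Complex.two_pi_I_ne_zero
    have hlt' : ((_ : ℕ) : ℝ) < ((_ : ℕ) : ℝ) := Nat.cast_lt.mpr hlt
    push_cast at hlt'
  · rw [log_neg_I_mul_sub_log_I_mul_of_pos (by linarith)] at key
    have : (zerosInDisk (wordPoly (patternWord m l)) : ℂ) = (2 * m : ℕ) := by
      apply mul_left_cancel₀ hpi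
      push_cast
      linear_combination key
    exact_mod_cast this
  · rw [log_neg_I_mul_sub_log_I_mul_of_neg (by linarith)] at key
    have : (zerosInDisk (wordPoly (patternWord m l)) : ℂ) = (2 * m + 1 : ℕ) := by
      apply mul_left_cancel₀ hpi
      push_cast
      linear_combination key
    exact_mod_cast this
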